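/- **Notation.** A primitive lattice triangulation of a polygon is a triangulation whose vertices lie in $\mathbb Z^2$ and whose triangles all have area $1/2$. For integers $a\ge-1$ and $b,c,d,e\ge0$ let $f_{a,b,c,d,e}$ be the number of primitive lattice triangulations of the polygon $[(0,a),(1,b),(2,c),(3,d),(4,e),(4,0),(0,-1)]$ having no interior edge of the form $[(0,y_1),(4,y_2)]$. Define in the same way, replacing the upper boundary by the indicated chain and under the indicated congruences (with $a\ge-1$ and all other indices $\ge 0$): - $g^{(1)}_{a,c,d,e}$: $(0,a),(2,c),(3,d),(4,e)$, $c-a\equiv1\ (2)$; $g^{(2)}_{a,b,d,e}$: $(0,a),(1,b),(3,d),(4,e)$, $d-b\equiv1\ (2)$; $g^{(3)}_{a,b,c,e}$: $(0,a),(1,b),(2,c),(4,e)$, $e-c\equiv1\ (2)$; - $h^{(1)}_{a,d,e}$, $h^{(2)}_{a,d,e}$: $(0,a),(3,d),(4,e)$, $d-a\equiv1$, resp. $2\ (3)$; $h^{(3)}_{a,c,e}$: $(0,a),(2,c),(4,e)$, $c-a\equiv e-c\equiv1\ (2)$; $h^{(4)}_{a,b,e}$, $h^{(5)}_{a,b,e}$: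 $(0,a),(1,b),(4,e)$, $e-b\equiv1$, resp. $2\ (3)$; - $j^{(1)}_{a,e}$, $j^{(2)}_{a,e}$: $(0,a),(4,e)$, $e-a\equiv1$, resp. $3\ (4)$, with $j^{(1)}_{-1,0}=0$. If an inequality or congruence fails, the number is $0$. Let $F(x,y,z,w,v)=\sum f_{a,b,c,d,e}x^ay^bz^cw^dv^e$, and let $G_1(x,z,w,v)$, $G_2(x,y,w,v)$, $G_3(x,y,z,v)$, $H_1(x,w,v)$, $H_2(x,w,v)$, $H_3(x,z,v)$, $H_4(x,y,v)$, $H_5(x,y,v)$, $J_1(x,v)$, $J_2(x,v)$ be the analogous generating functions ($x,y,z,w,v$ correspond to $a,b,c,d,e$). Put $$\widetilde F(x,y,z,w,v)=F(x,y,z,w,v)+F(v,w,z,y,x),\quad \widetilde G_1(x,z,w,v)=G_1(x,z,w,v)+G_3(v,w,z,x),$$ $$\widetilde G_2(x,y,w,v)=G_2(x,y,w,v)+G_2(v,w,y,x),\quad \widetilde H_k(x,w,v)=H_k(x,w,v)+H_{6-k}(v,w,x)\ (k=1,2),$$ $$\widetilde H_3(x,z,v)=H_3(x,z,v)+H_3(v,z,x),\quad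 \widetilde J_1(x,v)=J_1(x,v)+J_2(v,x),$$ $$Q(x,y,z,w,v)=1-x-y-z-w-v+xz+xw+xv+yw+yv+zv-xzv.$$ In the ring $\mathbb Z[t^{\pm1},s^{\pm1},u^{\pm1}]((x))$ of Laurent series in $x$ whose coefficients are Laurent polynomials in $t,s,u$, consider $$f=\widetilde F\Big(\tfrac xt,\tfrac{x^2t^2}s,\tfrac{x^2s^2}{tu},\tfrac{x^2u^2}s,\tfrac xu\Big),\quad q=Q\Big(\tfrac xt,\tfrac{x^2t^2}s,\tfrac{x^2s^2}{tu},\tfrac{x^2u^2}s,\tfrac xu\Big),$$ $$g_1=s^{-1/2}\,\widetilde G_1\Big(\tfrac{x^2}{s^{1/2}},\tfrac{x^3s^{3/2}}u,\tfrac{x^2u^2}s,\tfrac xu\Big),\quad g_2=(tu)^{-1/2}\,\widetilde G_2\Big(\tfrac xt,\tfrac{x^3t^{3/2}}{u^{1/2}},\tfrac{x^3u^{3/2}}{t^{1/2}},\tfrac xu\Big),$$ $$h_k=u^{-k/3}\,\widetilde H_k\Big(\tfrac{x^3}{u^{1/3}},x^4u^{4/3},\tfrac xu\Big)\ (k=1,2),\quad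 h_3=\widetilde H_3\Big(\tfrac{x^2}{s^{1/2}},x^4s,\tfrac{x^2}{s^{1/2}}\Big),\quad j_1=\widetilde J_1(x^4,x^4),$$ $$p=1-\tfrac{x^2u^2}s-\tfrac xu,\qquad r=\Big(1-\tfrac xt\Big)\Big(1-\tfrac xu\Big),$$ and, writing $\mathrm{cf}_{\mathbf m}$ for the coefficient of the monomial $\mathbf m$ (a series in the remaining variables), $$\Phi_1=\mathrm{cf}_{t^{-1}}\frac tq,\quad \Phi_2=\mathrm{cf}_{s^{-1}}\frac sq,\quad \Phi_3=\mathrm{cf}_{t^{-1}u^{-1}}\frac{tu}q,$$ $$\Psi_1=1-\frac{x^2}s\,p\,\Phi_1,\quad \Psi_2=1-\frac{x^2}{tu}\,r\,\Phi_2,\quad \Psi_3=1-\frac{x^4}{s^2}\Phi_3.$$ For a series $\mathcal F$ in this ring, $R_x(\mathcal F)$ is the supremum of those $x_0>0$ such that $\mathcal F$ converges (absolutely, as a multiple Laurent series) in a neighbourhood in $\mathbb C^4$ of $[0,x_0]\times\mathbb T^3$, where $\mathbb T=\{|z|=1\}$. **Lemma.** The elements $q$, $p$, $r$, $p\Psi_1$,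 $r\Psi_2$, $\Psi_3$ are invertible in $\mathbb Z[t^{\pm1},s^{\pm1},u^{\pm1}]((x))$. All nonzero coefficients of $f$, $g_1$, $g_2$, $h_1$, $h_2$, $h_3$, $j_1$, $\Phi_1$, $\Phi_2$, $\Phi_3$, $1/q$, $1/p$, $1/r$, $1/(p\Psi_1)$, $1/(r\Psi_2)$, $1/\Psi_3$ are positive. Moreover $$R_x(1/q)=\tfrac12,\qquad R_x(1/p)=\tfrac{-1+\sqrt5}2,\qquad R_x(1/r)=1.$$ -/

import Mathlib

noncomputable section

namespace Strip4

/-! ### The ring `ℤ[t^{±1}, s^{±1}, u^{±1}]((x))` -/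

/-- Laurent polynomials over `ℤ` in three variables; the exponent vector `m : Fin 3 → ℤ` stands for
the monomial `t ^ m 0 * s ^ m 1 * u ^ m 2`. -/
abbrev LPoly : Type := AddMonoidAlgebra ℤ (Fin 3 → ℤ)

/-- Formal Laurent series in `x` whose coefficients are Laurent polynomials in `t, s, u`. -/
abbrev Ser : Type := LaurentSeries LPoly

/-- The coefficient of `x ^ n * t ^ m 0 * s ^ m 1 * u ^ m 2`. -/
def Ser.cof (F : Ser) (n : ℤ) (m : Fin 3 → ℤ) : ℤ := (F.coeff n).coeff m

/-- The monomial `x ^ n * t ^ i * s ^ j * u ^ k`. -/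
def mono (n i j k : ℤ) : Ser := HahnSeries.single n (AddMonoidAlgebra.single ![i, j, k] 1)

/-- The coefficient of `(i-th variable) ^ (-1)` in a Laurent polynomial, as a Laurent polynomial
in the other two variables. -/
def cfHom (i : Fin 3) : LPoly →+ LPoly where
  toFun p := AddMonoidAlgebra.ofCoeff
    ((p.coeff.filter fun m => m i = -1).mapDomain fun m => Function.update m i 0)
  map_zero' := by
    simp [AddMonoidAlgebra.coeff_zero, Finsupp.filter_zero]
  map_add' p q := by
    rw [AddMonoidAlgebra.coeff_add, Finsupp.filter_add, Finsupp.mapDomain_add,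
      AddMonoidAlgebra.ofCoeff_add]

/-- `cf i F` is the coefficient of `(i-th variable) ^ (-1)` in `F`; the variables numbered
`0, 1, 2` are `t, s, u`. -/
def cf (i : Fin 3) (F : Ser) : Ser := HahnSeries.map F (cfHom i)

/-- All coefficients are positive, i.e. all nonzero coefficients are `> 0` (many are zero). -/
def Pos (F : Ser) : Prop := ∀ (n : ℤ) (m : Fin 3 → ℤ), 0 ≤ F.cof n m

/-- The series `F` converges (absolutely, as a multiple Laurent series) in a neighbourhood in `ℂ⁴`
of the product of `[0, x₀]` and of the torus `|t| = |s| = |u| = 1`. -/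
def ConvergesNear (F : Ser) (x₀ : ℝ) : Prop :=
  ∃ U : Set (ℂ × (Fin 3 → ℂ)), IsOpen U ∧
    (∀ (r : ℝ) (τ : Fin 3 → ℂ), 0 ≤ r → r ≤ x₀ → (∀ i, ‖τ i‖ = 1) → ((r : ℂ), τ) ∈ U) ∧
    ∀ z ∈ U, Summable fun nm : ℤ × (Fin 3 → ℤ) =>
      (F.cof nm.1 nm.2 : ℂ) * z.1 ^ nm.1 * ∏ i, z.2 i ^ nm.2 i

/-- The `x`-radius of convergence. -/
def Rx (F : Ser) : ENNReal :=
  ⨆ (x₀ : ℝ) (_ : 0 < x₀ ∧ ConvergesNear F x₀), ENNReal.ofReal x₀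

/-! ### Primitive lattice triangulations of shapes -/

/-- The embedding of the lattice in the plane. -/
def toPlane (P : ℤ × ℤ) : ℝ × ℝ := ((P.1 : ℝ), (P.2 : ℝ))

/-- The convex hull in the plane of a finite set of lattice points. -/
def hull (T : Finset (ℤ × ℤ)) : Set (ℝ × ℝ) := convexHull ℝ (toPlane '' (T : Set (ℤ × ℤ)))

/-- `T` is the vertex set of a lattice triangle of area `1/2`. -/
def IsPrimitiveTriangle (T : Finset (ℤ × ℤ)) : Prop :=
  ∃ P Q R : ℤ × ℤ, T = {P, Q, R} ∧
    |(Q.1 - P.1) * (R.2 - P.2) - (R.1 - P.1) * (Q.2 - P.2)| = 1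

/-- `𝒯` is (the set of the vertex sets of the triangles of) a primitive lattice triangulation of the
region `D`: the triangles are primitive, they cover `D` exactly, and any two of them meet along the
hull of their common vertices, that is, along a common face or not at all. -/
def IsPrimitiveTriangulation (𝒯 : Finset (Finset (ℤ × ℤ))) (D : Set (ℝ × ℝ)) : Prop :=
  (∀ T ∈ 𝒯, IsPrimitiveTriangle T) ∧ (⋃ T ∈ 𝒯, hull T) = D ∧
    ∀ T ∈ 𝒯, ∀ T' ∈ 𝒯, hull T ∩ hull T' = hull (T ∩ T')

/-- The points of the plane which lie over the polygonal chain's projection to the horizontal axis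
and which are not above the chain. The chain is given by its vertices from left to right. -/
def belowChain : List (ℤ × ℤ) → Set (ℝ × ℝ)
  | P :: Q :: L => {z | (P.1 : ℝ) ≤ z.1 ∧ z.1 ≤ Q.1 ∧
      (z.2 - P.2) * (Q.1 - P.1) ≤ (Q.2 - P.2) * (z.1 - P.1)} ∪ belowChain (Q :: L)
  | _ => ∅

/-- The polygon bounded from above by the chain `L` (which goes from the line `x = 0` to the line
`x = 4`), from below by the segment `[(0,-1), (4,0)]`, and by the vertical lines `x = 0`, `x = 4`. -/
def shape (L : List (ℤ × ℤ)) : Set (ℝ × ℝ) := belowChain L ∩ {z | z.1 / 4 - 1 ≤ z.2}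

/-- The triangulation has an edge with one end on the line `x = 0` and the other one on the line
`x = 4` which is interior, i.e. not contained in the boundary of `D`. -/
def HasInteriorSideToSideEdge (𝒯 : Finset (Finset (ℤ × ℤ))) (D : Set (ℝ × ℝ)) : Prop :=
  ∃ T ∈ 𝒯, ∃ y₁ y₂ : ℤ, (0, y₁) ∈ T ∧ (4, y₂) ∈ T ∧
    ¬ segment ℝ (toPlane (0, y₁)) (toPlane (4, y₂)) ⊆ frontier D

/-- The number of primitive lattice triangulations of the shape bounded from above by `L` without
interior side-to-side edges. -/
def count (L : List (ℤ × ℤ)) : ℕ :=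
  Set.ncard {𝒯 : Finset (Finset (ℤ × ℤ)) |
    IsPrimitiveTriangulation 𝒯 (shape L) ∧ ¬ HasInteriorSideToSideEdge 𝒯 (shape L)}

/-! ### The numbers `f, g, h, j` -/

def fNum (a b c d e : ℤ) : ℕ :=
  if -1 ≤ a ∧ 0 ≤ b ∧ 0 ≤ c ∧ 0 ≤ d ∧ 0 ≤ e then
    count [(0, a), (1, b), (2, c), (3, d), (4, e)] else 0

def g1Num (a c d e : ℤ) : ℕ :=
  if -1 ≤ a ∧ 0 ≤ c ∧ 0 ≤ d ∧ 0 ≤ e ∧ c - a ≡ 1 [ZMOD 2] then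
    count [(0, a), (2, c), (3, d), (4, e)] else 0

def g2Num (a b d e : ℤ) : ℕ :=
  if -1 ≤ a ∧ 0 ≤ b ∧ 0 ≤ d ∧ 0 ≤ e ∧ d - b ≡ 1 [ZMOD 2] then
    count [(0, a), (1, b), (3, d), (4, e)] else 0

def g3Num (a b c e : ℤ) : ℕ :=
  if -1 ≤ a ∧ 0 ≤ b ∧ 0 ≤ c ∧ 0 ≤ e ∧ e - c ≡ 1 [ZMOD 2] then
    count [(0, a), (1, b), (2, c), (4, e)] else 0

def h1Num (a d e : ℤ) : ℕ :=
  if -1 ≤ a ∧ 0 ≤ d ∧ 0 ≤ e ∧ d - a ≡ 1 [ZMOD 3] then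
    count [(0, a), (3, d), (4, e)] else 0

def h2Num (a d e : ℤ) : ℕ :=
  if -1 ≤ a ∧ 0 ≤ d ∧ 0 ≤ e ∧ d - a ≡ 2 [ZMOD 3] then
    count [(0, a), (3, d), (4, e)] else 0

def h3Num (a c e : ℤ) : ℕ :=
  if -1 ≤ a ∧ 0 ≤ c ∧ 0 ≤ e ∧ c - a ≡ 1 [ZMOD 2] ∧ e - c ≡ 1 [ZMOD 2] then
    count [(0, a), (2, c), (4, e)] else 0

def h4Num (a b e : ℤ) : ℕ :=
  if -1 ≤ a ∧ 0 ≤ b ∧ 0 ≤ e ∧ e - b ≡ 1 [ZMOD 3] then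
    count [(0, a), (1, b), (4, e)] else 0

def h5Num (a b e : ℤ) : ℕ :=
  if -1 ≤ a ∧ 0 ≤ b ∧ 0 ≤ e ∧ e - b ≡ 2 [ZMOD 3] then
    count [(0, a), (1, b), (4, e)] else 0

/-- For `(a, e) = (-1, 0)` the shape degenerates to a segment and the number is zero by
convention. -/
def j1Num (a e : ℤ) : ℕ :=
  if -1 ≤ a ∧ 0 ≤ e ∧ e - a ≡ 1 [ZMOD 4] ∧ ¬ (a = -1 ∧ e = 0) then
    count [(0, a), (4, e)] else 0

def j2Num (a e : ℤ) : ℕ :=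
  if -1 ≤ a ∧ 0 ≤ e ∧ e - a ≡ 3 [ZMOD 4] then count [(0, a), (4, e)] else 0

/-! ### The symmetrized generating functions, after the change of variables

The symmetrized function `F(x,y,z,w,v) + F(v,w,z,y,x)` has the coefficient
`fNum a b c d e + fNum e d c b a` at `x^a y^b z^c w^d v^e`, and similarly for the other ones. In
these functions, all variables are then replaced by monomials in `x, t, s, u`. -/

theorem finite_index {N : ℕ} (w : Fin N → ℕ) (hw : ∀ i, 1 ≤ w i) (n : ℤ) :
    {v : Fin N → ℤ | (∀ i, -1 ≤ v i) ∧ ∑ i, (w i : ℤ) * v i = n}.Finite := by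
  refine (Set.finite_Icc (fun _ => (-1 : ℤ)) (fun _ => n + ∑ i, (w i : ℤ))).subset ?_
  rintro v ⟨h1, h2⟩
  refine ⟨h1, fun i => ?_⟩
  have hs : ∑ j, (w j : ℤ) * (v j + 1) = n + ∑ j, (w j : ℤ) := by
    simp only [mul_add, mul_one, Finset.sum_add_distrib, h2]
  have hi : (w i : ℤ) * (v i + 1) ≤ ∑ j, (w j : ℤ) * (v j + 1) :=
    Finset.single_le_sum (f := fun j => (w j : ℤ) * (v j + 1))
      (fun j _ => mul_nonneg (by positivity) (by have := h1 j; omega)) (Finset.mem_univ i)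
  have hw' : (1 : ℤ) ≤ w i := by exact_mod_cast hw i
  have : v i + 1 ≤ (w i : ℤ) * (v i + 1) := by have := h1 i; nlinarith
  change v i ≤ n + ∑ j, (w j : ℤ)
  omega

theorem genSeries_bdd {N : ℕ} (w : Fin N → ℕ) (ex : (Fin N → ℤ) → Fin 3 → ℤ)
    (c : (Fin N → ℤ) → ℕ) :
    BddBelow (Function.support fun n : ℤ =>
      ∑ᶠ v ∈ {v : Fin N → ℤ | (∀ i, -1 ≤ v i) ∧ ∑ i, (w i : ℤ) * v i = n},
        (AddMonoidAlgebra.single (ex v) (c v : ℤ) : LPoly)) := by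
  refine ⟨-∑ i, (w i : ℤ), fun n hn => ?_⟩
  by_contra hlt
  refine hn ?_
  refine finsum_mem_eq_zero_of_forall_eq_zero ?_
  rintro v ⟨h1, h2⟩
  exfalso
  have hs : ∑ j, (w j : ℤ) * (v j + 1) = n + ∑ j, (w j : ℤ) := by
    simp only [mul_add, mul_one, Finset.sum_add_distrib, h2]
  have : 0 ≤ ∑ j, (w j : ℤ) * (v j + 1) :=
    Finset.sum_nonneg fun j _ => mul_nonneg (by positivity) (by have := h1 j; omega)
  omega

/-- The series `∑_v c(v) x^{w_0 v_0 + w_1 v_1 + ⋯} t^{ex(v)_0} s^{ex(v)_1} u^{ex(v)_2}` over all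
`v` with all `v_i ≥ -1`. For positive weights `w_i` any power of `x` occurs in finitely many terms
(see `finite_index`). -/
def genSeries {N : ℕ} (w : Fin N → ℕ) (ex : (Fin N → ℤ) → Fin 3 → ℤ)
    (c : (Fin N → ℤ) → ℕ) : Ser :=
  HahnSeries.ofSuppBddBelow (fun n : ℤ =>
    ∑ᶠ v ∈ {v : Fin N → ℤ | (∀ i, -1 ≤ v i) ∧ ∑ i, (w i : ℤ) * v i = n},
      (AddMonoidAlgebra.single (ex v) (c v : ℤ) : LPoly)) (genSeries_bdd w ex c)

/-- `f(t,s,u) = F̃(x/t, x²t²/s, x²s²/(tu), x²u²/s, x/u)`. -/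
def fSer : Ser :=
  genSeries ![1, 2, 2, 2, 1]
    (fun v => ![-v 0 + 2 * v 1 - v 2, -v 1 + 2 * v 2 - v 3, -v 2 + 2 * v 3 - v 4])
    (fun v => fNum (v 0) (v 1) (v 2) (v 3) (v 4) + fNum (v 4) (v 3) (v 2) (v 1) (v 0))

/-- `g₁(s,u) = s^{-1/2} G̃₁(x²/s^{1/2}, x³s^{3/2}/u, x²u²/s, x/u)`; the division by `2` is exact
whenever the coefficient is nonzero. -/
def g1Ser : Ser :=
  genSeries ![2, 3, 2, 1]
    (fun v => ![0, (-v 0 + 3 * v 1 - 2 * v 2 - 1) / 2, -v 1 + 2 * v 2 - v 3])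
    (fun v => g1Num (v 0) (v 1) (v 2) (v 3) + g3Num (v 3) (v 2) (v 1) (v 0))

/-- `g₂(t,u) = (tu)^{-1/2} G̃₂(x/t, x³t^{3/2}/u^{1/2}, x³u^{3/2}/t^{1/2}, x/u)`; the divisions by
`2` are exact whenever the coefficient is nonzero. -/
def g2Ser : Ser :=
  genSeries ![1, 3, 3, 1]
    (fun v => ![(-2 * v 0 + 3 * v 1 - v 2 - 1) / 2, 0, (-v 1 + 3 * v 2 - 2 * v 3 - 1) / 2])
    (fun v => g2Num (v 0) (v 1) (v 2) (v 3) + g2Num (v 3) (v 2) (v 1) (v 0))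

/-- `h₁(u) = u^{-1/3} H̃₁(x³/u^{1/3}, x⁴u^{4/3}, x/u)`; the division by `3` is exact whenever the
coefficient is nonzero. -/
def h1Ser : Ser :=
  genSeries ![3, 4, 1]
    (fun v => ![0, 0, (-v 0 + 4 * v 1 - 3 * v 2 - 1) / 3])
    (fun v => h1Num (v 0) (v 1) (v 2) + h5Num (v 2) (v 1) (v 0))

/-- `h₂(u) = u^{-2/3} H̃₂(x³/u^{1/3}, x⁴u^{4/3}, x/u)`; the division by `3` is exact whenever the
coefficient is nonzero. -/
def h2Ser : Ser :=
  genSeries ![3, 4, 1]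
    (fun v => ![0, 0, (-v 0 + 4 * v 1 - 3 * v 2 - 2) / 3])
    (fun v => h2Num (v 0) (v 1) (v 2) + h4Num (v 2) (v 1) (v 0))

/-- `h₃(s) = H̃₃(x²/s^{1/2}, x⁴s, x²/s^{1/2})`; the division by `2` is exact whenever the
coefficient is nonzero. -/
def h3Ser : Ser :=
  genSeries ![2, 4, 2]
    (fun v => ![0, (-v 0 + 2 * v 1 - v 2) / 2, 0])
    (fun v => h3Num (v 0) (v 1) (v 2) + h3Num (v 2) (v 1) (v 0))

/-- `j₁(x) = J̃₁(x⁴, x⁴)`. -/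
def j1Ser : Ser :=
  genSeries ![4, 4] (fun _ => ![0, 0, 0])
    (fun v => j1Num (v 0) (v 1) + j2Num (v 1) (v 0))

/-! ### The series `q, p, r, Φ_k, Ψ_k` -/

/-- The polynomial `Q(x,y,z,w,v)`. -/
def bigQ (x y z w v : Ser) : Ser :=
  1 - x - y - z - w - v + x * z + x * w + x * v + y * w + y * v + z * v - x * z * v

/-- `q(t,s,u) = Q(x/t, x²t²/s, x²s²/(tu), x²u²/s, x/u)`. -/
def q : Ser :=
  bigQ (mono 1 (-1) 0 0) (mono 2 2 (-1) 0) (mono 2 (-1) 2 (-1)) (mono 2 0 (-1) 2) (mono 1 0 0 (-1))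

/-- `p(s,u) = 1 - x²u²/s - x/u`. -/
def p : Ser := 1 - mono 2 0 (-1) 2 - mono 1 0 0 (-1)

/-- `r(t,u) = (1 - x/t)(1 - x/u)`. -/
def r : Ser := (1 - mono 1 (-1) 0 0) * (1 - mono 1 0 0 (-1))

/-- The inverse in the ring `Ser` (the junk value `0` on non-units is excluded in the theorem). -/
def recip (F : Ser) : Ser := Ring.inverse F

/-- `Φ₁(s,u) = cf_{t^{-1}} (t/q)`. -/
def Φ₁ : Ser := cf 0 (mono 0 1 0 0 * recip q)

/-- `Φ₂(t,u) = cf_{s^{-1}} (s/q)`. -/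
def Φ₂ : Ser := cf 1 (mono 0 0 1 0 * recip q)

/-- `Φ₃(s) = cf_{t^{-1}u^{-1}} (tu/q)`. -/
def Φ₃ : Ser := cf 0 (cf 2 (mono 0 1 0 1 * recip q))

/-- `Ψ₁ = 1 - (x²/s) p Φ₁`. -/
def Ψ₁ : Ser := 1 - mono 2 0 (-1) 0 * p * Φ₁

/-- `Ψ₂ = 1 - (x²/(tu)) r Φ₂`. -/
def Ψ₂ : Ser := 1 - mono 2 (-1) 0 (-1) * r * Φ₂

/-- `Ψ₃ = 1 - (x⁴/s²) Φ₃`. -/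
def Ψ₃ : Ser := 1 - mono 4 0 (-2) 0 * Φ₃

end Strip4

end

noncomputable section

namespace Strip4

open scoped ENNReal Topology

/-! The generating series are positive because their coefficients are counts; nothing about
triangulations is used. Everything else rests on one observation: `Q` is the signed independence
polynomial of the path x - y - z - w - v, the sum of (-1)^|I| times the product of the weights over
independent sets I of vertices (`q_eq`). Likewise `p` belongs to the path w - v, and `r` is (1 -
x)(1 - v).

For a path with first weight a, P(L) = P(tail) - a P(tail of tail). Hence P(tail)/P(L) is the
continued fraction 1/(1 - a/(1 - b/(1 - ...))), a nest of geometric series in positive terms of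
positive x-degree (`contFrac_mul_pathPoly`). Multiplying these fractions over all tails gives 1/P(L)
(`pathPoly_mul_pathInv`), so 1/q and 1/p are positive. Extracting coefficients preserves positivity,
which settles the Φ's and, by a geometric series, 1/Ψ₃.

Although `p` and `r` have negative coefficients, p/q and r/q are positive (`tame_p_mul_recip_q`,
`tame_r_mul_recip_q`). Since `p` does not involve t and `r` does not involve s, they pass through
the coefficient extractions: p Φ₁ and r Φ₂ are coefficients of t p/q and s r/q. Thus 1/(p Ψ₁) and
1/(r Ψ₂) are products of 1/p, 1/r with geometric series in positive terms.

For the radii, a positive series is evaluated at positive reals with values in [0, ∞], where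
evaluation is multiplicative and turns geometric series into 1/(1 - value) without any convergence
hypothesis (`norm_mul`, `norm_geo`). So 1/P(L) is finite when all tails of the path have positive
polynomial, and infinite when the whole polynomial vanishes while the proper tails stay positive. On
the torus, q = (1 - 2x)(1 - 2x²) and p = 1 - x - x² at t = s = u = 1, whence the radii (`Rx_eq`). -/

/-! ### Positive series -/

/-- The semiring of Laurent polynomials with nonnegative coefficients. -/
def nonneg : Subsemiring LPoly where
  carrier := {a | ∀ m, 0 ≤ a.coeff m}
  mul_mem' {a b} ha hb m := by
    classical
    rw [AddMonoidAlgebra.coeff_mul]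
    refine Finset.sum_nonneg fun i _ => Finset.sum_nonneg fun j _ => ?_
    dsimp only
    split_ifs
    · exact mul_nonneg (ha i) (hb j)
    · exact le_rfl
  one_mem' m := by
    classical
    rw [AddMonoidAlgebra.one_def, AddMonoidAlgebra.coeff_single, Finsupp.single_apply]
    split_ifs <;> simp
  add_mem' {a b} ha hb m := by
    rw [AddMonoidAlgebra.coeff_add]
    exact add_nonneg (ha m) (hb m)
  zero_mem' m := le_rfl

theorem single_mem_nonneg (m : Fin 3 → ℤ) {c : ℤ} (hc : 0 ≤ c) :
    (AddMonoidAlgebra.single m c : LPoly) ∈ nonneg := by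
  classical
  intro k
  rw [AddMonoidAlgebra.coeff_single, Finsupp.single_apply]
  split_ifs
  exacts [hc, le_rfl]

theorem pos_iff {F : Ser} : Pos F ↔ ∀ n, F.coeff n ∈ nonneg := Iff.rfl

theorem Pos.mul {F G : Ser} (hF : Pos F) (hG : Pos G) : Pos (F * G) := by
  rw [pos_iff] at *
  intro n
  rw [HahnSeries.coeff_mul]
  exact sum_mem fun i _ => mul_mem (hF _) (hG _)

theorem pos_one : Pos (1 : Ser) := by
  classical
  rw [pos_iff]
  intro n
  rw [HahnSeries.coeff_one]
  split_ifs
  exacts [one_mem _, zero_mem _]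

theorem Pos.pow {F : Ser} (hF : Pos F) (k : ℕ) : Pos (F ^ k) := by
  induction k with
  | zero => simpa using pos_one
  | succ k ih => rw [pow_succ]; exact ih.mul hF

theorem pos_mono (n i j k : ℤ) : Pos (mono n i j k) := by
  classical
  rw [pos_iff]
  intro l
  rw [mono, HahnSeries.coeff_single]
  split_ifs
  exacts [single_mem_nonneg _ zero_le_one, zero_mem _]

theorem pos_genSeries {N : ℕ} (w : Fin N → ℕ) (ex : (Fin N → ℤ) → Fin 3 → ℤ)
    (c : (Fin N → ℤ) → ℕ) : Pos (genSeries w ex c) := by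
  rw [pos_iff]
  intro n
  refine finsum_mem_induction (· ∈ nonneg) (zero_mem _) (fun _ _ => add_mem) fun v _ => ?_
  exact single_mem_nonneg _ (Int.natCast_nonneg _)

theorem cfHom_single (i : Fin 3) (m : Fin 3 → ℤ) (c : ℤ) :
    cfHom i (AddMonoidAlgebra.single m c) =
      if m i = -1 then AddMonoidAlgebra.single (Function.update m i 0) c else 0 := by
  change AddMonoidAlgebra.ofCoeff (((Finsupp.single m c).filter fun m => m i = -1).mapDomain
    fun m => Function.update m i 0) = _
  split_ifs with h
  · rw [Finsupp.filter_single_of_pos (fun m : Fin 3 → ℤ => m i = -1) h, Finsupp.mapDomain_single]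
    rfl
  · rw [Finsupp.filter_single_of_neg (fun m : Fin 3 → ℤ => m i = -1) h, Finsupp.mapDomain_zero]
    rfl

theorem cfHom_mem_nonneg (i : Fin 3) {a : LPoly} (ha : a ∈ nonneg) : cfHom i a ∈ nonneg := by
  rw [← AddMonoidAlgebra.sum_coeff_single a, Finsupp.sum, map_sum]
  refine sum_mem fun m _ => ?_
  rw [cfHom_single]
  split_ifs
  exacts [single_mem_nonneg _ (ha m), zero_mem _]

theorem Pos.cf {F : Ser} (hF : Pos F) (i : Fin 3) : Pos (cf i F) :=
  fun n => cfHom_mem_nonneg i (hF n)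

/-- A monomial free of the i-th variable leaves the exponent of that variable unchanged, so it acts
as a scalar for the extraction. -/
theorem cfHom_single_mul (i : Fin 3) {m : Fin 3 → ℤ} (hm : m i = 0) (a : LPoly) :
    cfHom i (AddMonoidAlgebra.single m 1 * a) = AddMonoidAlgebra.single m 1 * cfHom i a := by
  induction a using AddMonoidAlgebra.induction_linear with
  | zero => simp
  | add a b ha hb => rw [mul_add, map_add, ha, hb, map_add, mul_add]
  | single k c =>
    rw [AddMonoidAlgebra.single_mul_single, cfHom_single, cfHom_single, Pi.add_apply, hm, zero_add]
    split_ifs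
    · rw [AddMonoidAlgebra.single_mul_single]
      congr 1
      ext l
      by_cases h : l = i
      · subst h; simp [hm]
      · simp [h]
    · rw [mul_zero]

theorem cf_single_mul (i : Fin 3) (n : ℤ) {m : Fin 3 → ℤ} (hm : m i = 0) (F : Ser) :
    cf i (HahnSeries.single n (AddMonoidAlgebra.single m 1) * F) =
      HahnSeries.single n (AddMonoidAlgebra.single m 1) * cf i F := by
  ext1
  funext l
  rw [HahnSeries.coeff_single_mul]
  change cfHom i (HahnSeries.coeff _ _) = _ * cfHom i (F.coeff _)
  rw [HahnSeries.coeff_single_mul, cfHom_single_mul i hm]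

theorem cf_sub (i : Fin 3) (F G : Ser) : cf i (F - G) = cf i F - cf i G := by
  ext1
  funext l
  exact map_sub (cfHom i) _ _

/-! ### Orders in `x` -/

theorem orderTop_mul_nonneg {F G : Ser} (hF : 0 ≤ F.orderTop) (hG : 0 ≤ G.orderTop) :
    0 ≤ (F * G).orderTop :=
  (add_nonneg hF hG).trans HahnSeries.orderTop_add_le_mul

theorem orderTop_mul_pos {F G : Ser} (hF : 0 < F.orderTop) (hG : 0 ≤ G.orderTop) :
    0 < (F * G).orderTop :=
  (add_pos_of_pos_of_nonneg hF hG).trans_le HahnSeries.orderTop_add_le_mul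

theorem orderTop_mono (n i j k : ℤ) : (mono n i j k).orderTop = n := by
  refine HahnSeries.orderTop_single ?_
  rw [Ne, AddMonoidAlgebra.single_eq_zero]
  exact one_ne_zero

theorem orderTop_cf_nonneg {F : Ser} (hF : 0 ≤ F.orderTop) (i : Fin 3) :
    0 ≤ (cf i F).orderTop := by
  rw [HahnSeries.le_orderTop_iff_forall] at *
  intro n hn
  change cfHom i (F.coeff n) = 0
  rw [hF n hn, map_zero]

/-! ### Geometric series -/

/-- The geometric series `1 + F + F² + ⋯`. -/
def geo (F : Ser) : Ser := (HahnSeries.SummableFamily.powers F).hsum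

theorem one_sub_mul_geo {F : Ser} (h : 0 < F.orderTop) : (1 - F) * geo F = 1 :=
  HahnSeries.SummableFamily.one_sub_self_mul_hsum_powers h

theorem coeff_geo {F : Ser} (h : 0 < F.orderTop) (n : ℤ) :
    (geo F).coeff n = ∑ᶠ k : ℕ, (F ^ k).coeff n := by
  rw [geo, HahnSeries.SummableFamily.coeff_hsum]
  simp only [HahnSeries.SummableFamily.powers_of_orderTop_pos h]

theorem Pos.geo {F : Ser} (hF : Pos F) (h : 0 < F.orderTop) : Pos (geo F) := by
  rw [pos_iff]
  intro n
  rw [coeff_geo h]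
  exact finsum_induction (· ∈ nonneg) (zero_mem _) (fun _ _ => add_mem) fun k => hF.pow k n

theorem orderTop_pow_nonneg {F : Ser} (h : 0 ≤ F.orderTop) (k : ℕ) : 0 ≤ (F ^ k).orderTop :=
  (nsmul_nonneg h k).trans HahnSeries.orderTop_nsmul_le_orderTop_pow

theorem orderTop_geo_nonneg {F : Ser} (h : 0 < F.orderTop) : 0 ≤ (geo F).orderTop := by
  rw [HahnSeries.le_orderTop_iff_forall]
  intro n hn
  rw [coeff_geo h]
  refine finsum_eq_zero_of_forall_eq_zero fun k => ?_
  exact HahnSeries.coeff_eq_zero_of_lt_orderTop (hn.trans_le (orderTop_pow_nonneg h.le k))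

theorem recip_eq_of_mul_eq_one {F G : Ser} (h : F * G = 1) : recip F = G := by
  have := Ring.inverse_unit (⟨F, G, h, by rw [mul_comm, h]⟩ : Serˣ)
  exact this

/-! ### Evaluation of positive series at positive reals -/

/-- A point of the positive orthant: the absolute values of `x` and of `t, s, u`. -/
structure Polyradius where
  /-- The absolute value of `x`. -/
  rho : ℝ
  /-- The absolute values of `t, s, u`. -/
  sig : Fin 3 → ℝ
  rho_pos : 0 < rho
  sig_pos : ∀ i, 0 < sig i

namespace Polyradius

variable (P : Polyradius)

/-- The value of the monomial `t ^ m 0 * s ^ m 1 * u ^ m 2`. -/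
def weight : Multiplicative (Fin 3 → ℤ) →* ℝ where
  toFun m := ∏ i, P.sig i ^ (m.toAdd i)
  map_one' := by simp
  map_mul' a b := by
    rw [← Finset.prod_mul_distrib]
    exact Finset.prod_congr rfl fun i _ => zpow_add₀ (P.sig_pos i).ne' _ _

/-- Evaluation of Laurent polynomials. -/
def evalL : LPoly →+* ℝ :=
  AddMonoidAlgebra.liftNCRingHom (Int.castRingHom ℝ) P.weight fun _ _ => Commute.all _ _

theorem evalL_single (m : Fin 3 → ℤ) (c : ℤ) :
    P.evalL (AddMonoidAlgebra.single m c) = c * ∏ i, P.sig i ^ m i :=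
  AddMonoidAlgebra.liftNCRingHom_single _ _ _ _ _

theorem weight_pos (m : Fin 3 → ℤ) : 0 < ∏ i, P.sig i ^ m i :=
  Finset.prod_pos fun i _ => zpow_pos (P.sig_pos i) _

theorem evalL_eq_sum (a : LPoly) :
    P.evalL a = ∑ m ∈ a.coeff.support, (a.coeff m : ℝ) * ∏ i, P.sig i ^ m i := by
  conv_lhs => rw [← AddMonoidAlgebra.sum_coeff_single a, Finsupp.sum, map_sum]
  exact Finset.sum_congr rfl fun m _ => P.evalL_single _ _

theorem evalL_nonneg {a : LPoly} (ha : a ∈ nonneg) : 0 ≤ P.evalL a := by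
  rw [evalL_eq_sum]
  exact Finset.sum_nonneg fun m _ =>
    mul_nonneg (Int.cast_nonneg (ha m)) (P.weight_pos m).le

/-- The value of the part of degree `n` in `x`. -/
def term (F : Ser) (n : ℤ) : ℝ := P.evalL (F.coeff n) * P.rho ^ n

/-- The value of a positive series. -/
def norm (F : Ser) : ℝ≥0∞ := ∑' n : ℤ, ENNReal.ofReal (P.term F n)

theorem term_nonneg {F : Ser} (hF : Pos F) (n : ℤ) : 0 ≤ P.term F n :=
  mul_nonneg (P.evalL_nonneg (hF n)) (zpow_pos P.rho_pos n).le

theorem term_mul (F G : Ser) (n : ℤ) :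
    P.term (F * G) n = ∑ ij ∈ Finset.antidiagonal F.isPWO_support G.isPWO_support n,
      P.term F ij.1 * P.term G ij.2 := by
  rw [term, HahnSeries.coeff_mul, map_sum, Finset.sum_mul]
  refine Finset.sum_congr rfl fun ij h => ?_
  rw [Finset.mem_antidiagonal] at h
  rw [← h.2.2, zpow_add₀ P.rho_pos.ne', map_mul, term, term]
  ring

theorem ofReal_term_mul {F G : Ser} (hF : Pos F) (hG : Pos G) (n : ℤ) :
    ENNReal.ofReal (P.term (F * G) n) =
      ∑' i : ℤ, ENNReal.ofReal (P.term F i) * ENNReal.ofReal (P.term G (n - i)) := by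
  classical
  rw [term_mul, ENNReal.ofReal_sum_of_nonneg fun ij _ =>
    mul_nonneg (P.term_nonneg hF _) (P.term_nonneg hG _)]
  have hz : ∀ {H : Ser} {i : ℤ}, P.term H i ≠ 0 → i ∈ H.support := by
    intro H i h h0
    exact h (by rw [term, h0, map_zero, zero_mul])
  -- Only finitely many i contribute: both factors are nonzero only on the supports, and the pair
  -- (i, n - i) is determined by i.
  rw [tsum_eq_sum (s := (Finset.antidiagonal F.isPWO_support G.isPWO_support n).image Prod.fst)]
  · rw [Finset.sum_image]
    · refine Finset.sum_congr rfl fun ij h => ?_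
      rw [Finset.mem_antidiagonal] at h
      rw [← h.2.2, add_sub_cancel_left, ENNReal.ofReal_mul (P.term_nonneg hF _)]
    · intro a ha b hb hab
      rw [Finset.mem_coe, Finset.mem_antidiagonal] at ha hb
      exact Prod.ext hab (by have := ha.2.2; have := hb.2.2; omega)
  · intro i hi
    by_contra h
    rw [← ENNReal.ofReal_mul (P.term_nonneg hF _)] at h
    have h' : P.term F i * P.term G (n - i) ≠ 0 := fun h0 => h (by rw [h0, ENNReal.ofReal_zero])
    refine hi (Finset.mem_image.2 ⟨(i, n - i), ?_, rfl⟩)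
    rw [Finset.mem_antidiagonal]
    exact ⟨hz (left_ne_zero_of_mul h'), hz (right_ne_zero_of_mul h'), by simp⟩

/-- Cauchy product plus exchange of summations, which is unconditional in [0, ∞]. -/
theorem norm_mul {F G : Ser} (hF : Pos F) (hG : Pos G) : P.norm (F * G) = P.norm F * P.norm G := by
  simp only [norm, P.ofReal_term_mul hF hG]
  rw [ENNReal.tsum_comm, ← ENNReal.tsum_mul_right]
  refine tsum_congr fun i => ?_
  rw [ENNReal.tsum_mul_left]
  congr 1
  exact (Equiv.subRight i).tsum_eq fun n => ENNReal.ofReal (P.term G n)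

theorem norm_mono (n i j k : ℤ) :
    P.norm (mono n i j k) =
      ENNReal.ofReal (P.rho ^ n * (P.sig 0 ^ i * P.sig 1 ^ j * P.sig 2 ^ k)) := by
  rw [norm, tsum_eq_single n]
  · rw [term, mono, HahnSeries.coeff_single_same, evalL_single, Fin.prod_univ_three]
    simp [mul_comm]
  · intro l hl
    rw [term, mono, HahnSeries.coeff_single_of_ne hl, map_zero, zero_mul, ENNReal.ofReal_zero]

theorem norm_one : P.norm 1 = 1 := by
  have h := P.norm_mono 0 0 0 0
  have h1 : mono 0 0 0 0 = 1 := by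
    rw [mono, ← HahnSeries.single_zero_one, AddMonoidAlgebra.one_def]
    congr 2
    ext i
    fin_cases i <;> rfl
  rw [h1] at h
  simpa using h

theorem norm_pow {F : Ser} (hF : Pos F) (k : ℕ) : P.norm (F ^ k) = P.norm F ^ k := by
  induction k with
  | zero => simpa using P.norm_one
  | succ k ih => rw [pow_succ, P.norm_mul (hF.pow k) hF, ih, pow_succ]

/-- Sum over powers and sum over degrees are exchanged; each degree meets only finitely many powers.
Truncated subtraction makes the right side infinite as soon as the value of `F` is at least 1. -/
theorem norm_geo {F : Ser} (hF : Pos F) (h : 0 < F.orderTop) :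
    P.norm (geo F) = (1 - P.norm F)⁻¹ := by
  rw [← ENNReal.tsum_geometric]
  simp only [← P.norm_pow hF]
  simp only [norm]
  rw [ENNReal.tsum_comm]
  refine tsum_congr fun n => ?_
  have hfin : (Function.support fun k : ℕ =>
      (HahnSeries.SummableFamily.powers F k).coeff n).Finite :=
    (HahnSeries.SummableFamily.powers F).finite_co_support n
  simp only [HahnSeries.SummableFamily.powers_of_orderTop_pos h] at hfin
  rw [term, coeff_geo h, finsum_eq_sum _ hfin, map_sum, Finset.sum_mul,
    ENNReal.ofReal_sum_of_nonneg (f := fun k => P.evalL ((F ^ k).coeff n) * P.rho ^ n)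
      fun k _ => P.term_nonneg (hF.pow k) n]
  symm
  refine tsum_eq_sum fun k hk => ?_
  have hk' : (F ^ k).coeff n = 0 := by
    by_contra hne
    exact hk (hfin.mem_toFinset.2 hne)
  rw [term, hk', map_zero, zero_mul, ENNReal.ofReal_zero]

/-- Needed because 0 * ∞ = 0: a nonzero factor cannot hide a divergent one. -/
theorem norm_geo_ne_zero {F : Ser} (hF : Pos F) (h : 0 < F.orderTop) : P.norm (geo F) ≠ 0 := by
  rw [P.norm_geo hF h]
  exact ENNReal.inv_ne_zero.2 (ne_top_of_le_ne_top ENNReal.one_ne_top tsub_le_self)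

end Polyradius

/-! ### The radius of convergence of a positive series -/

namespace Polyradius

variable (P : Polyradius)

theorem norm_eq_tsum_cof {F : Ser} (hF : Pos F) :
    P.norm F = ∑' nm : ℤ × (Fin 3 → ℤ),
      ENNReal.ofReal ((F.cof nm.1 nm.2 : ℝ) * P.rho ^ nm.1 * ∏ i, P.sig i ^ nm.2 i) := by
  have hnn : ∀ n m, 0 ≤ (F.cof n m : ℝ) * P.rho ^ n * ∏ i, P.sig i ^ m i := fun n m =>
    mul_nonneg (mul_nonneg (Int.cast_nonneg (hF n m)) (zpow_pos P.rho_pos n).le)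
      (P.weight_pos m).le
  rw [ENNReal.tsum_prod', norm]
  refine tsum_congr fun n => ?_
  rw [term, evalL_eq_sum, Finset.sum_mul, tsum_eq_sum (s := (F.coeff n).coeff.support),
    ← ENNReal.ofReal_sum_of_nonneg fun m _ => hnn n m]
  · congr 1
    refine Finset.sum_congr rfl fun m _ => ?_
    rw [Ser.cof]
    ring
  · intro m hm
    rw [Finsupp.notMem_support_iff] at hm
    simp [Ser.cof, hm]

theorem norm_ne_top_iff_summable {F : Ser} (hF : Pos F) :
    P.norm F ≠ ⊤ ↔ Summable fun nm : ℤ × (Fin 3 → ℤ) =>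
      (F.cof nm.1 nm.2 : ℝ) * P.rho ^ nm.1 * ∏ i, P.sig i ^ nm.2 i := by
  rw [P.norm_eq_tsum_cof hF]
  refine ⟨fun h => ?_, fun h => h.tsum_ofReal_ne_top⟩
  refine (ENNReal.summable_toReal h).congr fun nm => ENNReal.toReal_ofReal ?_
  exact mul_nonneg (mul_nonneg (Int.cast_nonneg (hF _ _)) (zpow_pos P.rho_pos _).le)
    (P.weight_pos _).le

end Polyradius

/-- The series is dominated termwise by its value at the radii `ρ` and |t|, |s|, |u|; nonnegative
x-order allows every |x| < `ρ`, including x = 0. -/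
theorem convergesNear_of_norm_ne_top {F : Ser} (hF : Pos F) (h0 : 0 ≤ F.orderTop) {x₀ ρ : ℝ}
    (hx : x₀ < ρ)
    (hfin : ∀ᶠ σ in 𝓝 (1 : Fin 3 → ℝ), ∀ P : Polyradius, P.rho = ρ → P.sig = σ → P.norm F ≠ ⊤) :
    ConvergesNear F x₀ := by
  have hpos : ∀ᶠ σ in 𝓝 (1 : Fin 3 → ℝ), ∀ i, 0 < σ i :=
    Filter.eventually_all.2 fun i =>
      (continuous_apply i).continuousAt.eventually (lt_mem_nhds zero_lt_one)
  obtain ⟨A, hA, hAo, hA1⟩ := eventually_nhds_iff.1 (hfin.and hpos)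
  refine ⟨{z | ‖z.1‖ < ρ} ∩ {z | (fun i => ‖z.2 i‖) ∈ A}, ?_, ?_, ?_⟩
  · exact (isOpen_lt (by fun_prop) (by fun_prop)).inter (hAo.preimage (by fun_prop))
  · intro r τ hr hrx hτ
    refine ⟨?_, ?_⟩
    · change ‖(r : ℂ)‖ < ρ
      rw [Complex.norm_of_nonneg hr]
      exact hrx.trans_lt hx
    · change (fun i => ‖τ i‖) ∈ A
      simp only [hτ]
      exact hA1
  · rintro ⟨z, τ⟩ ⟨hz, hτ⟩
    have hz : ‖z‖ < ρ := hz
    obtain ⟨hτ1, hτ2⟩ := hA _ hτ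
    let P : Polyradius := ⟨ρ, _, (norm_nonneg _).trans_lt hz, hτ2⟩
    refine Summable.of_norm_bounded ((P.norm_ne_top_iff_summable hF).1 (hτ1 P rfl rfl)) ?_
    rintro ⟨n, m⟩
    rw [norm_mul, norm_mul, norm_prod]
    simp only [norm_zpow]
    have hc : ‖(F.cof n m : ℂ)‖ = (F.cof n m : ℝ) := by
      rw [Complex.norm_intCast, abs_of_nonneg (Int.cast_nonneg (hF n m))]
    rw [hc]
    refine mul_le_mul_of_nonneg_right ?_ (P.weight_pos m).le
    -- For negative n the comparison of powers is reversed, but there the coefficient vanishes.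
    by_cases hn : n < 0
    · have : F.cof n m = 0 := by
        rw [Ser.cof, HahnSeries.le_orderTop_iff_forall.1 h0 n (by exact_mod_cast hn)]
        rfl
      simp [this]
    · refine mul_le_mul_of_nonneg_left ?_ (Int.cast_nonneg (hF n m))
      exact zpow_le_zpow_left₀ (not_lt.1 hn) (norm_nonneg _) hz.le

/-- For a positive series, divergence at the single point x = c, t = s = u = 1 bounds the radius by
c. Finiteness below c, for moduli of t, s, u near 1, gives the other bound. -/
theorem Rx_eq {F : Ser} (hF : Pos F) (h0 : 0 ≤ F.orderTop) {c : ℝ} (hc : 0 < c)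
    (hfin : ∀ ρ, 0 < ρ → ρ < c → ∀ᶠ σ in 𝓝 (1 : Fin 3 → ℝ), ∀ P : Polyradius,
      P.rho = ρ → P.sig = σ → P.norm F ≠ ⊤)
    (htop : ∀ P : Polyradius, P.rho = c → P.sig = 1 → P.norm F = ⊤) :
    Rx F = ENNReal.ofReal c := by
  apply le_antisymm
  · refine iSup₂_le fun x₀ hx => ENNReal.ofReal_le_ofReal ?_
    by_contra! hlt
    obtain ⟨-, U, -, hU, hsum⟩ := hx
    have hs := (hsum _ (hU c 1 hc.le hlt.le (by simp))).norm
    let P : Polyradius := ⟨c, 1, hc, fun _ => zero_lt_one⟩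
    refine (P.norm_ne_top_iff_summable hF).2 ?_ (htop P rfl rfl)
    refine hs.congr fun nm => ?_
    have h1 : (0 : ℝ) ≤ F.cof nm.1 nm.2 := Int.cast_nonneg (hF _ _)
    simp [P, abs_of_pos hc, abs_of_nonneg h1]
  · have hlim : Filter.Tendsto ENNReal.ofReal (𝓝[<] c) (𝓝 (ENNReal.ofReal c)) :=
      ENNReal.continuous_ofReal.continuousAt.tendsto.mono_left nhdsWithin_le_nhds
    refine le_of_tendsto hlim ?_
    filter_upwards [Ioo_mem_nhdsLT hc] with x₀ hx
    obtain ⟨ρ, h1, h2⟩ := exists_between hx.2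
    refine le_iSup₂_of_le x₀ ⟨hx.1, ?_⟩ le_rfl
    exact convergesNear_of_norm_ne_top hF h0 h1 (hfin ρ (hx.1.trans h1) h2)

/-! ### Independence polynomials of paths and continued fractions -/

/-- The signed independence polynomial of a path whose vertices carry the given weights. -/
def pathPoly {R : Type*} [CommRing R] : List R → R
  | [] => 1
  | [a] => 1 - a
  | a :: b :: L => pathPoly (b :: L) - a * pathPoly L

/-- Independent sets either avoid the first vertex or contain it and avoid the second. Since the
tail of the empty list is empty, the one-vertex path obeys the same recursion. -/
theorem pathPoly_cons {R : Type*} [CommRing R] (a : R) (L : List R) :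
    pathPoly (a :: L) = pathPoly L - a * pathPoly L.tail := by
  cases L <;> simp [pathPoly]

/-- The continued fraction `1/(1 - a/(1 - b/(1 - ⋯)))`. -/
def contFrac : List Ser → Ser
  | [] => 1
  | a :: L => geo (a * contFrac L)

/-- Positive series with terms of positive degree in `x` only. -/
def Small (F : Ser) : Prop := Pos F ∧ 0 < F.orderTop

/-- Positive series with terms of nonnegative degree in `x` only. -/
def Tame (F : Ser) : Prop := Pos F ∧ 0 ≤ F.orderTop

theorem small_mono {n : ℤ} (hn : 0 < n) (i j k : ℤ) : Small (mono n i j k) :=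
  ⟨pos_mono _ _ _ _, by rw [orderTop_mono]; exact_mod_cast hn⟩

theorem tame_mono {n : ℤ} (hn : 0 ≤ n) (i j k : ℤ) : Tame (mono n i j k) :=
  ⟨pos_mono _ _ _ _, by rw [orderTop_mono]; exact_mod_cast hn⟩

theorem Small.mul {F G : Ser} (hF : Small F) (hG : Tame G) : Small (F * G) :=
  ⟨hF.1.mul hG.1, orderTop_mul_pos hF.2 hG.2⟩

theorem Tame.mul {F G : Ser} (hF : Tame F) (hG : Tame G) : Tame (F * G) :=
  ⟨hF.1.mul hG.1, orderTop_mul_nonneg hF.2 hG.2⟩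

theorem Tame.cf {F : Ser} (hF : Tame F) (i : Fin 3) : Tame (cf i F) :=
  ⟨hF.1.cf i, orderTop_cf_nonneg hF.2 i⟩

theorem Small.geo {F : Ser} (hF : Small F) : Tame (geo F) :=
  ⟨hF.1.geo hF.2, orderTop_geo_nonneg hF.2⟩

theorem tame_contFrac {L : List Ser} (hL : ∀ a ∈ L, Small a) : Tame (contFrac L) := by
  induction L with
  | nil => exact ⟨pos_one, by rw [contFrac, HahnSeries.orderTop_one]⟩
  | cons a L ih =>
    exact ((hL a (by simp)).mul (ih fun b hb => hL b (by simp [hb]))).geo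

theorem contFrac_mul_pathPoly {L : List Ser} (hL : ∀ a ∈ L, Small a) :
    contFrac L * pathPoly L = pathPoly L.tail := by
  induction L with
  | nil => simp [contFrac, pathPoly]
  | cons a L ih =>
    have hL' : ∀ b ∈ L, Small b := fun b hb => hL b (by simp [hb])
    have h1 := one_sub_mul_geo ((hL a (by simp)).mul (tame_contFrac hL')).2
    rw [pathPoly_cons, ← ih hL', contFrac, List.tail_cons]
    linear_combination pathPoly L * h1

/-- The independence polynomials of all the tails of a weighted path are positive. -/
def TailsPos : List ℝ → Prop
  | [] => True
  | a :: L => 0 < pathPoly (a :: L) ∧ TailsPos L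

theorem TailsPos.pathPoly_pos {L : List ℝ} (h : TailsPos L) : 0 < pathPoly L := by
  cases L with
  | nil => exact zero_lt_one
  | cons a L => exact h.1

theorem TailsPos.tail {L : List ℝ} (h : TailsPos L) : TailsPos L.tail := by
  cases L with
  | nil => exact h
  | cons a L => exact h.2

/-- The value of the monomial `x ^ n * t ^ i * s ^ j * u ^ k`. -/
def realMono (ρ : ℝ) (n i j k : ℤ) (σ : Fin 3 → ℝ) : ℝ :=
  ρ ^ n * (σ 0 ^ i * σ 1 ^ j * σ 2 ^ k)

namespace Polyradius

variable (P : Polyradius)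

/-- The real value of a positive series (junk if the series diverges). -/
def val (F : Ser) : ℝ := (P.norm F).toReal

theorem val_mono (n i j k : ℤ) :
    P.val (mono n i j k) = realMono P.rho n i j k P.sig := by
  rw [val, realMono, norm_mono, ENNReal.toReal_ofReal]
  exact (mul_pos (zpow_pos P.rho_pos _) (mul_pos (mul_pos (zpow_pos (P.sig_pos _) _)
    (zpow_pos (P.sig_pos _) _)) (zpow_pos (P.sig_pos _) _))).le

theorem norm_mono_ne_top (n i j k : ℤ) : P.norm (mono n i j k) ≠ ⊤ := by
  rw [norm_mono]
  exact ENNReal.ofReal_ne_top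

theorem norm_contFrac_cons {a : Ser} {L : List Ser} (ha : Small a) (hL : ∀ b ∈ L, Small b)
    (ha' : P.norm a ≠ ⊤) {y : ℝ} (hy0 : 0 ≤ y)
    (hy : P.norm (contFrac L) = ENNReal.ofReal y) :
    P.norm (contFrac (a :: L)) = (ENNReal.ofReal (1 - P.val a * y))⁻¹ := by
  have hL' := tame_contFrac hL
  rw [contFrac, P.norm_geo (ha.mul hL').1 (ha.mul hL').2, P.norm_mul ha.1 hL'.1, hy,
    ← ENNReal.ofReal_toReal ha', ← ENNReal.ofReal_mul ENNReal.toReal_nonneg,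
    ← ENNReal.ofReal_one]
  rw [val, ENNReal.ofReal_sub _ (mul_nonneg ENNReal.toReal_nonneg hy0)]

/-- Positivity of every tail polynomial keeps each nested denominator, a quotient of consecutive
tail polynomials, positive. Finiteness of the weights excludes the default value of `val`. -/
theorem norm_contFrac {L : List Ser} (hL : ∀ a ∈ L, Small a) (hf : ∀ a ∈ L, P.norm a ≠ ⊤)
    (hp : TailsPos (L.map P.val)) :
    P.norm (contFrac L) =
      ENNReal.ofReal (pathPoly (L.map P.val).tail / pathPoly (L.map P.val)) := by
  induction L with
  | nil => simp [contFrac, pathPoly, norm_one]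
  | cons a L ih =>
    have hp0 := hp.pathPoly_pos
    have hp1 : TailsPos (L.map P.val) := hp.2
    have hp2 := hp1.pathPoly_pos
    rw [P.norm_contFrac_cons (hL a (by simp)) (fun b hb => hL b (by simp [hb])) (hf a (by simp))
      (div_nonneg hp1.tail.pathPoly_pos.le hp2.le) (ih (fun b hb => hL b (by simp [hb])) (fun b hb => hf b (by simp [hb])) hp1)]
    rw [List.map_cons, List.tail_cons]
    rw [List.map_cons] at hp0
    have h : 1 - P.val a * (pathPoly (L.map P.val).tail / pathPoly (L.map P.val)) =
        pathPoly (P.val a :: L.map P.val) / pathPoly (L.map P.val) := by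
      rw [pathPoly_cons]
      field_simp
    rw [h, ← ENNReal.ofReal_inv_of_pos (div_pos hp0 hp2), inv_div]

/-- Only the outermost denominator vanishes; the inner fraction is still finite. -/
theorem norm_contFrac_eq_top {a : Ser} {L : List Ser} (ha : Small a) (hL : ∀ b ∈ L, Small b)
    (ha' : P.norm a ≠ ⊤) (hf : ∀ b ∈ L, P.norm b ≠ ⊤) (hp : TailsPos (L.map P.val))
    (h0 : pathPoly (P.val a :: L.map P.val) = 0) :
    P.norm (contFrac (a :: L)) = ⊤ := by
  have hp1 := hp.tail.pathPoly_pos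
  have hp2 := hp.pathPoly_pos
  rw [P.norm_contFrac_cons ha hL ha' (div_nonneg hp1.le hp2.le) (P.norm_contFrac hL hf hp)]
  rw [pathPoly_cons] at h0
  have h : 1 - P.val a * (pathPoly (L.map P.val).tail / pathPoly (L.map P.val)) = 0 := by
    field_simp
    rw [h0, mul_zero]
  rw [h, ENNReal.ofReal_zero, ENNReal.inv_zero]

theorem norm_contFrac_ne_zero {L : List Ser} (hL : ∀ a ∈ L, Small a) :
    P.norm (contFrac L) ≠ 0 := by
  cases L with
  | nil => rw [contFrac, norm_one]; exact one_ne_zero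
  | cons b L =>
    have hb := (hL b (by simp)).mul (tame_contFrac (L := L) fun c hc => hL c (by simp [hc]))
    exact P.norm_geo_ne_zero hb.1 hb.2

end Polyradius

/-- The inverse of the independence polynomial of a path. -/
def pathInv : List Ser → Ser
  | [] => 1
  | a :: L => contFrac (a :: L) * pathInv L

theorem tame_pathInv {L : List Ser} (hL : ∀ a ∈ L, Small a) : Tame (pathInv L) := by
  induction L with
  | nil => exact tame_contFrac (L := []) hL
  | cons a L ih => exact (tame_contFrac hL).mul (ih fun b hb => hL b (by simp [hb]))

/-- The quotients P(tail)/P(L) telescope along the path. -/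
theorem pathPoly_mul_pathInv {L : List Ser} (hL : ∀ a ∈ L, Small a) :
    pathPoly L * pathInv L = 1 := by
  induction L with
  | nil => simp [pathPoly, pathInv]
  | cons a L ih =>
    have h := contFrac_mul_pathPoly hL
    rw [List.tail_cons] at h
    rw [pathInv]
    linear_combination pathInv L * h + ih fun b hb => hL b (by simp [hb])

theorem Polyradius.norm_pathInv_ne_top (P : Polyradius) {L : List Ser} (hL : ∀ a ∈ L, Small a)
    (hf : ∀ a ∈ L, P.norm a ≠ ⊤) (hp : TailsPos (L.map P.val)) : P.norm (pathInv L) ≠ ⊤ := by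
  induction L with
  | nil => rw [pathInv, P.norm_one]; exact ENNReal.one_ne_top
  | cons a L ih =>
    have hL' : ∀ b ∈ L, Small b := fun b hb => hL b (by simp [hb])
    rw [pathInv, P.norm_mul (tame_contFrac hL).1 (tame_pathInv hL').1]
    refine ENNReal.mul_ne_top ?_ (ih hL' (fun b hb => hf b (by simp [hb])) hp.2)
    rw [P.norm_contFrac hL hf hp]
    exact ENNReal.ofReal_ne_top

theorem Polyradius.norm_pathInv_ne_zero (P : Polyradius) {L : List Ser}
    (hL : ∀ a ∈ L, Small a) : P.norm (pathInv L) ≠ 0 := by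
  induction L with
  | nil => rw [pathInv, P.norm_one]; exact one_ne_zero
  | cons a L ih =>
    have hL' : ∀ b ∈ L, Small b := fun b hb => hL b (by simp [hb])
    rw [pathInv, P.norm_mul (tame_contFrac hL).1 (tame_pathInv hL').1]
    exact mul_ne_zero (P.norm_contFrac_ne_zero hL) (ih hL')

theorem Polyradius.norm_pathInv_eq_top (P : Polyradius) {a : Ser} {L : List Ser} (ha : Small a)
    (hL : ∀ b ∈ L, Small b) (ha' : P.norm a ≠ ⊤) (hf : ∀ b ∈ L, P.norm b ≠ ⊤)
    (hp : TailsPos (L.map P.val)) (h0 : pathPoly (P.val a :: L.map P.val) = 0) :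
    P.norm (pathInv (a :: L)) = ⊤ := by
  have haL : ∀ b ∈ a :: L, Small b := by simpa [ha] using hL
  rw [pathInv, P.norm_mul (tame_contFrac haL).1 (tame_pathInv hL).1,
    P.norm_contFrac_eq_top ha hL ha' hf hp h0, ENNReal.top_mul (P.norm_pathInv_ne_zero hL)]

/-! ### The series of the theorem -/

theorem q_eq : q = pathPoly [mono 1 (-1) 0 0, mono 2 2 (-1) 0, mono 2 (-1) 2 (-1),
    mono 2 0 (-1) 2, mono 1 0 0 (-1)] := by
  simp only [q, bigQ, pathPoly]
  ring

theorem p_eq : p = pathPoly [mono 2 0 (-1) 2, mono 1 0 0 (-1)] := by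
  simp only [p, pathPoly]
  ring

theorem recip_pathPoly {L : List Ser} (hL : ∀ a ∈ L, Small a) :
    recip (pathPoly L) = pathInv L :=
  recip_eq_of_mul_eq_one (pathPoly_mul_pathInv hL)

theorem small_q : ∀ a ∈ [mono 1 (-1) 0 0, mono 2 2 (-1) 0, mono 2 (-1) 2 (-1),
    mono 2 0 (-1) 2, mono 1 0 0 (-1)], Small a := by
  simp only [List.forall_mem_cons, List.not_mem_nil, false_imp_iff, implies_true, and_true]
  refine ⟨?_, ?_, ?_, ?_, ?_⟩ <;> exact small_mono (by norm_num) _ _ _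

theorem small_p : ∀ a ∈ [mono 2 0 (-1) 2, mono 1 0 0 (-1)], Small a :=
  fun a ha => small_q a (by simp only [List.mem_cons] at ha ⊢; tauto)

theorem small_zwv : ∀ a ∈ [mono 2 (-1) 2 (-1), mono 2 0 (-1) 2, mono 1 0 0 (-1)], Small a :=
  fun a ha => small_q a (by simp only [List.mem_cons] at ha ⊢; tauto)

theorem small_x : Small (mono 1 (-1) 0 0) := small_mono (by norm_num) _ _ _

theorem small_v : Small (mono 1 0 0 (-1)) := small_mono (by norm_num) _ _ _

theorem recip_q : recip q = pathInv [mono 1 (-1) 0 0, mono 2 2 (-1) 0, mono 2 (-1) 2 (-1),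
    mono 2 0 (-1) 2, mono 1 0 0 (-1)] := by
  rw [q_eq, recip_pathPoly small_q]

theorem recip_p : recip p = pathInv [mono 2 0 (-1) 2, mono 1 0 0 (-1)] := by
  rw [p_eq, recip_pathPoly small_p]

theorem r_mul : r * (geo (mono 1 (-1) 0 0) * geo (mono 1 0 0 (-1))) = 1 := by
  have h1 := one_sub_mul_geo small_x.2
  have h2 := one_sub_mul_geo small_v.2
  rw [r]
  linear_combination (1 - mono 1 0 0 (-1)) * geo (mono 1 0 0 (-1)) * h1 + h2

theorem recip_r : recip r = geo (mono 1 (-1) 0 0) * geo (mono 1 0 0 (-1)) :=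
  recip_eq_of_mul_eq_one r_mul

theorem tame_recip_q : Tame (recip q) := by
  rw [recip_q]
  exact tame_pathInv small_q

theorem tame_recip_p : Tame (recip p) := by
  rw [recip_p]
  exact tame_pathInv small_p

theorem tame_recip_r : Tame (recip r) := by
  rw [recip_r]
  exact small_x.geo.mul small_v.geo

theorem p_mul_recip_p : p * recip p = 1 := by
  rw [recip_p, p_eq, pathPoly_mul_pathInv small_p]

theorem r_mul_recip_r : r * recip r = 1 := by
  rw [recip_r, r_mul]

theorem q_mul_recip_q : q * recip q = 1 := by
  rw [recip_q, q_eq, pathPoly_mul_pathInv small_q]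

/-- The path of `p` is a tail of the path of `q`, so p/q is the product of the first three
telescoping quotients. -/
theorem tame_p_mul_recip_q : Tame (p * recip q) := by
  have hs := small_q
  have h1 : p * recip q = contFrac [mono 1 (-1) 0 0, mono 2 2 (-1) 0, mono 2 (-1) 2 (-1),
      mono 2 0 (-1) 2, mono 1 0 0 (-1)] * (contFrac [mono 2 2 (-1) 0, mono 2 (-1) 2 (-1),
      mono 2 0 (-1) 2, mono 1 0 0 (-1)] * contFrac [mono 2 (-1) 2 (-1), mono 2 0 (-1) 2,
      mono 1 0 0 (-1)]) := by
    have h := p_mul_recip_p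
    rw [recip_p] at h
    rw [recip_q, pathInv, pathInv, pathInv]
    linear_combination contFrac [mono 1 (-1) 0 0, mono 2 2 (-1) 0, mono 2 (-1) 2 (-1),
      mono 2 0 (-1) 2, mono 1 0 0 (-1)] * (contFrac [mono 2 2 (-1) 0, mono 2 (-1) 2 (-1),
      mono 2 0 (-1) 2, mono 1 0 0 (-1)] * contFrac [mono 2 (-1) 2 (-1), mono 2 0 (-1) 2,
      mono 1 0 0 (-1)]) * h
  rw [h1]
  simp only [List.forall_mem_cons] at hs
  refine (tame_contFrac ?_).mul ((tame_contFrac ?_).mul (tame_contFrac ?_)) <;>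
    simp only [List.forall_mem_cons] <;> tauto

/-- Here the path is cut at its second vertex y. With c3 = P(w,v)/P(z,w,v) and c2 = (1 - v)/P(w,v),
r/q equals c3 c2 times the geometric series in y c3/(1 - x). -/
theorem tame_r_mul_recip_q : Tame (r * recip q) := by
  have hy : Small (mono 2 2 (-1) 0) := small_mono (by norm_num) _ _ _
  have hS : Small (mono 2 2 (-1) 0 * (geo (mono 1 (-1) 0 0) *
      contFrac [mono 2 (-1) 2 (-1), mono 2 0 (-1) 2, mono 1 0 0 (-1)])) :=
    hy.mul (small_x.geo.mul (tame_contFrac small_zwv))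
  have hT := hS.geo.mul ((tame_contFrac small_zwv).mul (tame_contFrac small_p))
  convert hT using 1
  have hx := one_sub_mul_geo small_x.2
  have hg := one_sub_mul_geo hS.2
  have h3 := contFrac_mul_pathPoly small_zwv
  have h2 := contFrac_mul_pathPoly small_p
  have hq := q_mul_recip_q
  generalize recip q = i at *
  rw [q_eq] at hq
  set c3 := contFrac [mono 2 (-1) 2 (-1), mono 2 0 (-1) 2, mono 1 0 0 (-1)]
  set c2 := contFrac [mono 2 0 (-1) 2, mono 1 0 0 (-1)]
  set g := geo (mono 2 2 (-1) 0 * (geo (mono 1 (-1) 0 0) * c3))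
  set gx := geo (mono 1 (-1) 0 0)
  rw [List.tail_cons] at h3 h2
  rw [r]
  generalize mono 1 (-1) 0 0 = x at *
  generalize mono 2 2 (-1) 0 = y at *
  generalize mono 2 (-1) 2 (-1) = z at *
  generalize mono 2 0 (-1) 2 = w at *
  generalize mono 1 0 0 (-1) = v at *
  -- Independent sets avoiding y contribute (1 - x) P(z,w,v), those containing y contribute -y
  -- P(w,v); the first part is then factored out.
  have hQ : pathPoly [x, y, z, w, v] =
      (1 - x) * pathPoly [z, w, v] * (1 - y * (gx * c3)) := by
    have : pathPoly [x, y, z, w, v] = (1 - x) * pathPoly [z, w, v] - y * pathPoly [w, v] := by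
      simp only [pathPoly]
      ring
    rw [this]
    linear_combination y * h3 + y * c3 * pathPoly [z, w, v] * hx
  have hv : pathPoly [v] = 1 - v := rfl
  rw [hQ] at hq
  rw [hv] at h2
  linear_combination g * (c3 * c2) * hq - (1 - x) * pathPoly [z, w, v] * c3 * c2 * i * hg -
    (1 - x) * c2 * i * h3 - (1 - x) * i * h2

theorem cf_p_mul (F : Ser) : p * cf 0 F = cf 0 (p * F) := by
  simp only [p, sub_mul, one_mul, cf_sub]
  rw [mono, mono, cf_single_mul 0 _ (by simp), cf_single_mul 0 _ (by simp)]

theorem cf_r_mul (F : Ser) : r * cf 1 F = cf 1 (r * F) := by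
  simp only [r, sub_mul, one_mul, cf_sub, mul_assoc, mul_sub]
  rw [mono, mono, cf_single_mul 1 _ (by simp), cf_single_mul 1 _ (by simp),
    cf_single_mul 1 _ (by simp), cf_single_mul 1 _ (by simp)]

theorem tame_Φ₁ : Tame Φ₁ := ((tame_mono le_rfl _ _ _).mul tame_recip_q).cf 0

theorem tame_Φ₂ : Tame Φ₂ := ((tame_mono le_rfl _ _ _).mul tame_recip_q).cf 1

theorem tame_Φ₃ : Tame Φ₃ := (((tame_mono le_rfl _ _ _).mul tame_recip_q).cf 2).cf 0

/-- `p` itself is not positive, so it is first moved inside the extraction, where it meets 1/q. -/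
theorem small_p_mul_Φ₁ : Small (mono 2 0 (-1) 0 * p * Φ₁) := by
  rw [mul_assoc, Φ₁, cf_p_mul, mul_left_comm]
  exact (small_mono (by norm_num) _ _ _).mul
    (((tame_mono le_rfl _ _ _).mul tame_p_mul_recip_q).cf 0)

theorem small_r_mul_Φ₂ : Small (mono 2 (-1) 0 (-1) * r * Φ₂) := by
  rw [mul_assoc, Φ₂, cf_r_mul, mul_left_comm]
  exact (small_mono (by norm_num) _ _ _).mul
    (((tame_mono le_rfl _ _ _).mul tame_r_mul_recip_q).cf 1)

theorem small_Φ₃ : Small (mono 4 0 (-2) 0 * Φ₃) :=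
  (small_mono (by norm_num) _ _ _).mul tame_Φ₃

theorem p_mul_Ψ₁_mul : p * Ψ₁ * (recip p * geo (mono 2 0 (-1) 0 * p * Φ₁)) = 1 := by
  have h := one_sub_mul_geo small_p_mul_Φ₁.2
  rw [Ψ₁, mul_mul_mul_comm, p_mul_recip_p, h, one_mul]

theorem r_mul_Ψ₂_mul : r * Ψ₂ * (recip r * geo (mono 2 (-1) 0 (-1) * r * Φ₂)) = 1 := by
  have h := one_sub_mul_geo small_r_mul_Φ₂.2
  rw [Ψ₂, mul_mul_mul_comm, r_mul_recip_r, h, one_mul]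

theorem Ψ₃_mul : Ψ₃ * geo (mono 4 0 (-2) 0 * Φ₃) = 1 := one_sub_mul_geo small_Φ₃.2

/-! ### The radii of convergence -/

theorem realMono_one (ρ : ℝ) (n i j k : ℤ) : realMono ρ n i j k 1 = ρ ^ n := by
  simp [realMono]

theorem continuousAt_realMono (ρ : ℝ) (n i j k : ℤ) : ContinuousAt (realMono ρ n i j k) 1 := by
  have h : ∀ (l : Fin 3) (m : ℤ), ContinuousAt (fun σ : Fin 3 → ℝ => σ l ^ m) 1 := fun l m =>
    (continuous_apply l).continuousAt.zpow₀ m (Or.inl one_ne_zero)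
  exact continuousAt_const.mul (((h 0 i).mul (h 1 j)).mul (h 2 k))

theorem continuousAt_pathPoly {σ₀ : Fin 3 → ℝ} :
    ∀ L : List ((Fin 3 → ℝ) → ℝ), (∀ f ∈ L, ContinuousAt f σ₀) →
      ContinuousAt (fun σ => pathPoly (L.map fun f => f σ)) σ₀
  | [], _ => continuousAt_const
  | [f], h => continuousAt_const.sub (h f (by simp))
  | f :: g :: L, h =>
    (continuousAt_pathPoly (g :: L) fun k hk => h k (by simp_all)).sub
      ((h f (by simp)).mul (continuousAt_pathPoly L fun k hk => h k (by simp [hk])))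

/-- Finitely many strict inequalities between continuous functions persist near the given point, so
convergence need only be checked on the torus. -/
theorem eventually_tailsPos {σ₀ : Fin 3 → ℝ} {L : List ((Fin 3 → ℝ) → ℝ)}
    (hL : ∀ f ∈ L, ContinuousAt f σ₀) (h : TailsPos (L.map fun f => f σ₀)) :
    ∀ᶠ σ in 𝓝 σ₀, TailsPos (L.map fun f => f σ) := by
  induction L with
  | nil => exact Filter.Eventually.of_forall fun _ => trivial
  | cons f L ih =>
    exact ((continuousAt_pathPoly _ hL).tendsto.eventually (lt_mem_nhds h.1)).and
      (ih (fun g hg => hL g (by simp [hg])) h.2)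

theorem Rx_recip_q : Rx (recip q) = ENNReal.ofReal (1 / 2) := by
  refine Rx_eq tame_recip_q.1 tame_recip_q.2 (by norm_num) ?_ ?_
  · intro ρ h0 h1
    have key := eventually_tailsPos (σ₀ := 1) (L := [realMono ρ 1 (-1) 0 0, realMono ρ 2 2 (-1) 0, realMono ρ 2 (-1) 2 (-1),
        realMono ρ 2 0 (-1) 2, realMono ρ 1 0 0 (-1)])
      (by simp [continuousAt_realMono]) (by
        simp only [List.map_cons, List.map_nil, realMono_one, TailsPos, pathPoly, zpow_ofNat,
          and_true]
        have h2 : 0 < 1 - 2 * ρ := by linarith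
        have h3 : 0 < 1 - 2 * ρ ^ 2 := by nlinarith
        refine ⟨?_, ?_, ?_, ?_, ?_⟩
        -- With t = s = u = 1 the five weights are ρ, ρ², ρ², ρ², ρ, and the full polynomial factors
        -- as (1 - 2ρ)(1 - 2ρ²). The proper tails are positive as 1 - 2ρ times a positive factor
        -- plus a power of ρ, down to 1 - ρ.
        · linear_combination mul_pos h2 h3
        · have h4 : 0 < 1 + ρ - ρ ^ 2 := by nlinarith
          linear_combination mul_pos h2 h4 + pow_pos h0 4
        · linear_combination mul_pos h2 (add_pos one_pos h0) + pow_pos h0 3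
        · linear_combination mul_pos h2 (add_pos one_pos h0) + pow_pos h0 2
        · linarith)
    filter_upwards [key] with σ hσ P hP1 hP2
    rw [recip_q]
    refine P.norm_pathInv_ne_top small_q ?_ ?_
    · simp [P.norm_mono_ne_top]
    · simpa only [List.map_cons, List.map_nil, P.val_mono, hP1, hP2] using hσ
  · intro P hP1 hP2
    have hs := small_q
    rw [List.forall_mem_cons] at hs
    rw [recip_q]
    refine P.norm_pathInv_eq_top hs.1 hs.2 (P.norm_mono_ne_top _ _ _ _) ?_ ?_ ?_
    · simp [P.norm_mono_ne_top]
    · simp only [List.map_cons, List.map_nil, P.val_mono, hP1, hP2, realMono_one,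
        TailsPos, pathPoly, zpow_ofNat, and_true]
      norm_num
    · simp only [List.map_cons, List.map_nil, P.val_mono, hP1, hP2, realMono_one,
        pathPoly, zpow_ofNat]
      norm_num

theorem Rx_recip_p : Rx (recip p) = ENNReal.ofReal ((-1 + Real.sqrt 5) / 2) := by
  have h5 : Real.sqrt 5 ^ 2 = 5 := Real.sq_sqrt (by norm_num)
  have h5' : 2 < Real.sqrt 5 := Real.lt_sqrt_of_sq_lt (by norm_num)
  have h5'' : Real.sqrt 5 < 3 := by nlinarith
  refine Rx_eq tame_recip_p.1 tame_recip_p.2 (by linarith) ?_ ?_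
  · intro ρ h0 h1
    have key := eventually_tailsPos (σ₀ := 1) (L := [realMono ρ 2 0 (-1) 2, realMono ρ 1 0 0 (-1)])
      (by simp [continuousAt_realMono]) (by
        simp only [List.map_cons, List.map_nil, realMono_one, TailsPos, pathPoly, zpow_ofNat,
          and_true]
        refine ⟨?_, ?_⟩
        · nlinarith
        · linarith)
    filter_upwards [key] with σ hσ P hP1 hP2
    rw [recip_p]
    refine P.norm_pathInv_ne_top small_p ?_ ?_
    · simp [P.norm_mono_ne_top]
    · simpa only [List.map_cons, List.map_nil, P.val_mono, hP1, hP2] using hσ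
  · intro P hP1 hP2
    have hs := small_p
    rw [List.forall_mem_cons] at hs
    rw [recip_p]
    refine P.norm_pathInv_eq_top hs.1 hs.2 (P.norm_mono_ne_top _ _ _ _) ?_ ?_ ?_
    · simp [P.norm_mono_ne_top]
    · simp only [List.map_cons, List.map_nil, P.val_mono, hP1, hP2, realMono_one,
        TailsPos, pathPoly, zpow_ofNat, and_true]
      linarith
    -- The golden ratio conjugate is the positive root of 1 - ρ - ρ².
    · simp only [List.map_cons, List.map_nil, P.val_mono, hP1, hP2, realMono_one,
        pathPoly, zpow_ofNat]
      nlinarith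

theorem Rx_recip_r : Rx (recip r) = 1 := by
  rw [← ENNReal.ofReal_one]
  have hnorm : ∀ P : Polyradius, P.norm (recip r) =
      (1 - P.norm (mono 1 (-1) 0 0))⁻¹ * (1 - P.norm (mono 1 0 0 (-1)))⁻¹ := by
    intro P
    rw [recip_r, P.norm_mul small_x.geo.1 small_v.geo.1, P.norm_geo small_x.1 small_x.2,
      P.norm_geo small_v.1 small_v.2]
  refine Rx_eq tame_recip_r.1 tame_recip_r.2 one_pos ?_ ?_
  · intro ρ h0 h1
    have h : ∀ n i j k, ρ ^ n < 1 → ∀ᶠ σ in 𝓝 (1 : Fin 3 → ℝ), realMono ρ n i j k σ < 1 :=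
      fun n i j k hn => (continuousAt_realMono ρ n i j k).tendsto.eventually
        (gt_mem_nhds (by rwa [realMono_one]))
    have key := (h 1 (-1) 0 0 (by simpa using h1)).and (h 1 0 0 (-1) (by simpa using h1))
    filter_upwards [key] with σ hσ P hP1 hP2
    rw [hnorm]
    simp only [P.norm_mono, hP1, hP2]
    refine ENNReal.mul_ne_top ?_ ?_ <;> rw [ENNReal.inv_ne_top, Ne, tsub_eq_zero_iff_le, not_le]
    · exact ENNReal.ofReal_lt_one.2 hσ.1
    · exact ENNReal.ofReal_lt_one.2 hσ.2
  · intro P hP1 hP2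
    rw [hnorm]
    -- Both factors are 1/(1 - 1) = ∞.
    simp [P.norm_mono, hP1, hP2]

end Strip4

end

theorem mainTheorem4 :
    (Strip4.Pos Strip4.fSer ∧
      Strip4.Pos Strip4.g1Ser ∧ Strip4.Pos Strip4.g2Ser ∧
      Strip4.Pos Strip4.h1Ser ∧ Strip4.Pos Strip4.h2Ser ∧ Strip4.Pos Strip4.h3Ser ∧
      Strip4.Pos Strip4.j1Ser) ∧
    (IsUnit Strip4.q ∧ IsUnit Strip4.p ∧ IsUnit Strip4.r ∧
      IsUnit (Strip4.p * Strip4.Ψ₁) ∧ IsUnit (Strip4.r * Strip4.Ψ₂) ∧ IsUnit Strip4.Ψ₃) ∧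
    (Strip4.Pos Strip4.Φ₁ ∧ Strip4.Pos Strip4.Φ₂ ∧ Strip4.Pos Strip4.Φ₃) ∧
    (Strip4.Pos (Strip4.recip Strip4.q) ∧ Strip4.Pos (Strip4.recip Strip4.p) ∧
      Strip4.Pos (Strip4.recip Strip4.r)) ∧
    (Strip4.Pos (Strip4.recip (Strip4.p * Strip4.Ψ₁)) ∧
      Strip4.Pos (Strip4.recip (Strip4.r * Strip4.Ψ₂)) ∧
      Strip4.Pos (Strip4.recip Strip4.Ψ₃)) ∧
    Strip4.Rx (Strip4.recip Strip4.q) = ENNReal.ofReal (1 / 2) ∧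
    Strip4.Rx (Strip4.recip Strip4.p) = ENNReal.ofReal ((-1 + Real.sqrt 5) / 2) ∧
    Strip4.Rx (Strip4.recip Strip4.r) = 1 := by
  open Strip4 in
  refine ⟨⟨pos_genSeries _ _ _, pos_genSeries _ _ _, pos_genSeries _ _ _, pos_genSeries _ _ _,
      pos_genSeries _ _ _, pos_genSeries _ _ _, pos_genSeries _ _ _⟩,
    ⟨IsUnit.of_mul_eq_one _ q_mul_recip_q, IsUnit.of_mul_eq_one _ p_mul_recip_p,
      IsUnit.of_mul_eq_one _ r_mul_recip_r, IsUnit.of_mul_eq_one _ p_mul_Ψ₁_mul,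
      IsUnit.of_mul_eq_one _ r_mul_Ψ₂_mul, IsUnit.of_mul_eq_one _ Ψ₃_mul⟩,
    ⟨tame_Φ₁.1, tame_Φ₂.1, tame_Φ₃.1⟩, ⟨tame_recip_q.1, tame_recip_p.1, tame_recip_r.1⟩,
    ⟨?_, ?_, ?_⟩, Rx_recip_q, Rx_recip_p, Rx_recip_r⟩
  · rw [recip_eq_of_mul_eq_one p_mul_Ψ₁_mul]
    exact (tame_recip_p.mul small_p_mul_Φ₁.geo).1
  · rw [recip_eq_of_mul_eq_one r_mul_Ψ₂_mul]
    exact (tame_recip_r.mul small_r_mul_Φ₂.geo).1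
  · rw [recip_eq_of_mul_eq_one Ψ₃_mul]
    exact small_Φ₃.geo.1
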